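/- Let $d,p\in\mathbb{N}$ and let $\{(\alpha_k,\beta_k) : k=0,1,2,\dots\}\subset\mathbb{R}^{d\times p}\times\mathbb{R}^p$ be independent, identically distributed random variables on a probability space such that $$\mathcal{H}=\{x\in\mathbb{R}^d : \mathbb{P}[\alpha_0^\intercal x=\beta_0]=1\}\neq\emptyset .$$ Let $x_0\in\mathbb{R}^d$ be deterministic and let $\{x_k\}$ be generated by streaming block Kaczmarz, $$x_{k+1}=x_k-\alpha_k(\alpha_k^\intercal\alpha_k)^\dagger(\alpha_k^\intercal x_k-\beta_k),\qquad k=0,1,2,\dots,$$ where $\dagger$ is the Moore--Penrose pseudo-inverse. Let $\mathcal{P}_{\mathcal{H}}$ be the orthogonal projection onto the affine subspace $\mathcal{H}$, and let stopping times be understood with respect to the filtration $\mathcal{F}_k=\sigma(\alpha_0,\beta_0,\dots,\alpha_{k-1},\beta_{k-1})$, $k = 0,1,2,\dots$. Then at least one of the following holds. 1. There exists a stopping time $\tau$ with finite expectation such that $x_\tau\in\mathcal{H}$ almost surely. 2. There exist $\pi\in(0,1]$, a sequence of non-negative (integer-valued) stopping times $\{\tau_j : j=0,1,2,\dots\}$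 with $$\mathbb{E}[\tau_j]\le j\left[\frac{(d-\dim\mathcal{H})-1}{\pi}+1\right]\quad\text{for all } j,$$ and $\bar\gamma\in(0,1)$ such that, for every $\gamma\in(\bar\gamma,1)$, $$\mathbb{P}\left[\bigcup_{L=0}^\infty\bigcap_{j=L}^\infty\left\{\|x_{\tau_j}-\mathcal{P}_{\mathcal{H}}x_0\|_2^2\le\gamma^j\,\|x_0-\mathcal{P}_{\mathcal{H}}x_0\|_2^2\right\}\right]=1 .$$ -/

import Mathlib

open MeasureTheory ProbabilityTheory Filter
open scoped Matrix ENNReal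

noncomputable section

namespace StreamingKaczmarz

/-- The four Penrose equations: `X` is the Moore-Penrose pseudo-inverse of the real matrix `A`. -/
structure IsMoorePenrose {m n : ℕ} (A : Matrix (Fin m) (Fin n) ℝ)
    (X : Matrix (Fin n) (Fin m) ℝ) : Prop where
  mul_mul_self : A * X * A = A
  mul_mul_inv : X * A * X = X
  symm_left : (A * X)ᵀ = A * X
  symm_right : (X * A)ᵀ = X * A

theorem IsMoorePenrose.unique {m n : ℕ} {A : Matrix (Fin m) (Fin n) ℝ}
    {X Y : Matrix (Fin n) (Fin m) ℝ} (hX : IsMoorePenrose A X) (hY : IsMoorePenrose A Y) :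
    X = Y := by
  have h1 : A * X = A * Y := by
    calc A * X = (A * X)ᵀ := hX.symm_left.symm
      _ = ((A * Y) * (A * X))ᵀ := by rw [← Matrix.mul_assoc, hY.mul_mul_self]
      _ = (A * X)ᵀ * (A * Y)ᵀ := Matrix.transpose_mul _ _
      _ = A * X * A * Y := by rw [hX.symm_left, hY.symm_left, ← Matrix.mul_assoc]
      _ = A * Y := by rw [hX.mul_mul_self]
  have h2 : X * A = Y * A := by
    calc X * A = (X * A)ᵀ := hX.symm_right.symm
      _ = ((X * A) * (Y * A))ᵀ := by
        rw [Matrix.mul_assoc, ← Matrix.mul_assoc A, hY.mul_mul_self]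
      _ = (Y * A)ᵀ * (X * A)ᵀ := Matrix.transpose_mul _ _
      _ = Y * (A * X * A) := by
        rw [hX.symm_right, hY.symm_right]; simp only [Matrix.mul_assoc]
      _ = Y * A := by rw [hX.mul_mul_self]
  calc X = X * A * X := hX.mul_mul_inv.symm
    _ = Y * (A * X) := by rw [h2, Matrix.mul_assoc]
    _ = Y := by rw [h1, ← Matrix.mul_assoc, hY.mul_mul_inv]

theorem exists_isMoorePenrose_of_symm {n : ℕ} (B : Matrix (Fin n) (Fin n) ℝ) (hB : B.IsHermitian) :
    ∃ G, IsMoorePenrose B G ∧ Gᵀ = G := by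
  obtain ⟨U, D, hU, hBe⟩ : ∃ (U : Matrix (Fin n) (Fin n) ℝ) (D : Fin n → ℝ),
      Uᵀ * U = 1 ∧ B = U * Matrix.diagonal D * Uᵀ := by
    refine ⟨hB.eigenvectorUnitary, hB.eigenvalues, ?_, ?_⟩
    · exact Unitary.coe_star_mul_self hB.eigenvectorUnitary
    · exact hB.spectral_theorem
  have key : ∀ M N : Matrix (Fin n) (Fin n) ℝ,
      (U * M * Uᵀ) * (U * N * Uᵀ) = U * (M * N) * Uᵀ := by
    intro M N
    calc (U * M * Uᵀ) * (U * N * Uᵀ) = U * M * (Uᵀ * U) * N * Uᵀ := by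
          simp only [Matrix.mul_assoc]
      _ = U * (M * N) * Uᵀ := by rw [hU]; simp only [Matrix.mul_assoc, Matrix.one_mul]
  have symm : ∀ d : Fin n → ℝ,
      (U * Matrix.diagonal d * Uᵀ)ᵀ = U * Matrix.diagonal d * Uᵀ := by
    intro d
    simp [Matrix.transpose_mul, Matrix.mul_assoc]
  have hD : ∀ i, D i * (D i)⁻¹ * D i = D i := fun i => mul_inv_mul_cancel (D i)
  have hD' : ∀ i, (D i)⁻¹ * D i * (D i)⁻¹ = (D i)⁻¹ := fun i => by
    simpa using mul_inv_mul_cancel (D i)⁻¹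
  refine ⟨U * Matrix.diagonal (fun i => (D i)⁻¹) * Uᵀ, ⟨?_, ?_, ?_, ?_⟩, symm _⟩
  · rw [hBe, key, key]; simp [hD]
  · rw [hBe, key, key]; simp [hD']
  · rw [hBe, key, Matrix.diagonal_mul_diagonal, symm]
  · rw [hBe, key, Matrix.diagonal_mul_diagonal, symm]

theorem exists_isMoorePenrose {m n : ℕ} (A : Matrix (Fin m) (Fin n) ℝ) :
    ∃ X, IsMoorePenrose A X := by
  obtain ⟨G, hG, hGs⟩ := exists_isMoorePenrose_of_symm (Aᵀ * A)
    (Matrix.isHermitian_conjTranspose_mul_self A)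
  refine ⟨G * Aᵀ, ?_, ?_, ?_, ?_⟩
  · have h : Aᴴ * A * (G * (Aᵀ * A) - 1) = 0 := by
      have := hG.mul_mul_self
      rw [Matrix.conjTranspose_eq_transpose_of_trivial, Matrix.mul_sub, Matrix.mul_one,
        ← Matrix.mul_assoc, this, sub_self]
    rw [Matrix.conjTranspose_mul_self_mul_eq_zero, Matrix.mul_sub, Matrix.mul_one, sub_eq_zero] at h
    simpa only [Matrix.mul_assoc] using h
  · have := congrArg (· * Aᵀ) hG.mul_mul_inv
    simpa only [Matrix.mul_assoc] using this
  · simp only [Matrix.transpose_mul, Matrix.transpose_transpose, hGs, Matrix.mul_assoc]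
  · have := hG.symm_right
    simpa only [Matrix.mul_assoc] using this

/-- The Moore-Penrose pseudo-inverse `A†`. -/
def pinv {m n : ℕ} (A : Matrix (Fin m) (Fin n) ℝ) : Matrix (Fin n) (Fin m) ℝ :=
  (exists_isMoorePenrose A).choose

theorem pinv_spec {m n : ℕ} (A : Matrix (Fin m) (Fin n) ℝ) : IsMoorePenrose A (pinv A) :=
  (exists_isMoorePenrose A).choose_spec

/-- The matrices `ℝ^{d × p}` with the product (Borel) σ-algebra. -/
instance instMeasurableSpaceMatrix {d p : ℕ} : MeasurableSpace (Matrix (Fin d) (Fin p) ℝ) :=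
  inferInstanceAs (MeasurableSpace (Fin d → Fin p → ℝ))

/-- One block Kaczmarz step `x - a (aᵀ a)† (aᵀ x - b)`. -/
def kaczmarzStep {d p : ℕ} (a : Matrix (Fin d) (Fin p) ℝ) (b : Fin p → ℝ) (x : EuclideanSpace ℝ (Fin d)) :
    EuclideanSpace ℝ (Fin d) :=
  x - WithLp.toLp 2 ((a * pinv (aᵀ * a)) *ᵥ (aᵀ *ᵥ x.ofLp - b))

variable {Ω : Type*} [MeasurableSpace Ω] {d p : ℕ}

/-- The block Kaczmarz iterates on the stream `(α k, β k)`, started at `x₀`. -/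
def kaczmarzIterate (α : ℕ → Ω → Matrix (Fin d) (Fin p) ℝ) (β : ℕ → Ω → Fin p → ℝ)
    (x₀ : EuclideanSpace ℝ (Fin d)) : ℕ → Ω → EuclideanSpace ℝ (Fin d)
  | 0, _ => x₀
  | k + 1, ω => kaczmarzStep (α k ω) (β k ω) (kaczmarzIterate α β x₀ k ω)

/-- The set of `x` with `aᵀ x = b` almost surely, as an affine subspace of `ℝ^d`. -/
def solutionSpace (μ : Measure Ω) (a : Ω → Matrix (Fin d) (Fin p) ℝ) (b : Ω → Fin p → ℝ) :
    AffineSubspace ℝ (EuclideanSpace ℝ (Fin d)) where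
  carrier := {x | ∀ᵐ ω ∂μ, (a ω)ᵀ *ᵥ x.ofLp = b ω}
  smul_vsub_vadd_mem' c x y z hx hy hz := by
    rw [Set.mem_ofPred_eq] at hx hy hz ⊢
    filter_upwards [hx, hy, hz] with ω h1 h2 h3
    simp [Matrix.mulVec_add, Matrix.mulVec_smul, Matrix.mulVec_sub, h1, h2, h3]

/-- The information available at iterate `k`: the σ-algebra generated by
`(α 0, β 0), …, (α (k - 1), β (k - 1))`. -/
def streamFiltration (α : ℕ → Ω → Matrix (Fin d) (Fin p) ℝ) (β : ℕ → Ω → Fin p → ℝ)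
    (hα : ∀ k, Measurable (α k)) (hβ : ∀ k, Measurable (β k)) :
    Filtration ℕ (inferInstance : MeasurableSpace Ω) where
  seq k := ⨆ i : Fin k, MeasurableSpace.comap (fun ω => (α i ω, β i ω)) inferInstance
  mono' _ k hjk := iSup_le fun i =>
    le_iSup (fun i : Fin k => MeasurableSpace.comap (fun ω => (α i ω, β i ω)) inferInstance)
      (Fin.castLE hjk i)
  le' _ := iSup_le fun i => ((hα i).prodMk (hβ i)).comap_le

/-- The expectation of an `ℕ ∪ {∞}`-valued random time. -/
def expectedTime (μ : Measure Ω) (τ : Ω → WithTop ℕ) : ℝ≥0∞ :=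
  ∫⁻ ω, ENat.toENNReal (τ ω) ∂μ

end StreamingKaczmarz

end

open StreamingKaczmarz

noncomputable section

namespace StreamingKaczmarz

variable {Ω : Type*} [MeasurableSpace Ω] {d p : ℕ}

/-! If `h` solves the sampled equation `aᵀ h = b`, one step replaces the error `x - h` by its
orthogonal projection off the columns of `a` (`kaczmarzStep_sub`). Taking `h` to be the projection
of `x₀` onto `H`, the error stays almost surely in the orthogonal complement of the direction of
`H`. That complement contains no nonzero vector almost surely orthogonal to all columns, so
compactness of its unit sphere gives a single factor `c < 1` bounding the mean-square contraction
(`exists_integral_norm_residual_sq_le`). Each sample is independent of the current iterate, so the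
mean-square error after `k` steps is at most `c ^ k` times the initial one
(`lintegral_kaczmarzIterate_sub_le`). Markov and Borel-Cantelli turn this into almost sure decay at
every rate `γ > c`. Hence deterministic times suffice: `τ = 0` if `x₀ ∈ H`, and otherwise `τ j = j`
with `π = 1`. -/

/-! ### Linear algebra of a single step. -/

theorem IsMoorePenrose.transpose {m n : ℕ} {A : Matrix (Fin m) (Fin n) ℝ}
    {X : Matrix (Fin n) (Fin m) ℝ} (h : IsMoorePenrose A X) : IsMoorePenrose Aᵀ Xᵀ where
  mul_mul_self := by
    simpa only [Matrix.transpose_mul, Matrix.mul_assoc] using congrArg Matrix.transpose h.mul_mul_self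
  mul_mul_inv := by
    simpa only [Matrix.transpose_mul, Matrix.mul_assoc] using congrArg Matrix.transpose h.mul_mul_inv
  symm_left := by rw [← Matrix.transpose_mul, h.symm_right, h.symm_right]
  symm_right := by rw [← Matrix.transpose_mul, h.symm_left, h.symm_left]

/-- The matrix `a (aᵀ a)† aᵀ` of the orthogonal projection onto the column space of `a`. -/
def colProj (a : Matrix (Fin d) (Fin p) ℝ) : Matrix (Fin d) (Fin d) ℝ :=
  a * pinv (aᵀ * a) * aᵀ

theorem transpose_pinv_gram (a : Matrix (Fin d) (Fin p) ℝ) :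
    (pinv (aᵀ * a))ᵀ = pinv (aᵀ * a) := by
  have h := (pinv_spec (aᵀ * a)).transpose
  rw [Matrix.transpose_mul, Matrix.transpose_transpose] at h
  exact h.unique (pinv_spec _)

theorem colProj_transpose (a : Matrix (Fin d) (Fin p) ℝ) : (colProj a)ᵀ = colProj a := by
  simp only [colProj, Matrix.transpose_mul, Matrix.transpose_transpose, transpose_pinv_gram,
    Matrix.mul_assoc]

theorem colProj_mul_self (a : Matrix (Fin d) (Fin p) ℝ) : colProj a * colProj a = colProj a := by
  have h := congrArg (fun M => a * M * aᵀ) (pinv_spec (aᵀ * a)).mul_mul_inv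
  simpa only [colProj, Matrix.mul_assoc] using h

/-- Over `ℝ`, `aᵀ a M = 0` forces `a M = 0`; this cancels `aᵀ` in the first Penrose equation for the
Gram matrix. -/
theorem colProj_mul (a : Matrix (Fin d) (Fin p) ℝ) : colProj a * a = a := by
  have h : aᴴ * a * (pinv (aᵀ * a) * (aᵀ * a) - 1) = 0 := by
    rw [Matrix.conjTranspose_eq_transpose_of_trivial, Matrix.mul_sub, Matrix.mul_one,
      ← Matrix.mul_assoc, (pinv_spec (aᵀ * a)).mul_mul_self, sub_self]
  rw [Matrix.conjTranspose_mul_self_mul_eq_zero, Matrix.mul_sub, Matrix.mul_one, sub_eq_zero] at h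
  simpa only [colProj, Matrix.mul_assoc] using h

/-- The component `v - a (aᵀ a)† aᵀ v` of `v` orthogonal to the columns of `a`. -/
def residual (a : Matrix (Fin d) (Fin p) ℝ) (v : EuclideanSpace ℝ (Fin d)) :
    EuclideanSpace ℝ (Fin d) :=
  v - WithLp.toLp 2 (colProj a *ᵥ v.ofLp)

theorem kaczmarzStep_sub {a : Matrix (Fin d) (Fin p) ℝ} {b : Fin p → ℝ}
    {h : EuclideanSpace ℝ (Fin d)} (hab : aᵀ *ᵥ h.ofLp = b) (x : EuclideanSpace ℝ (Fin d)) :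
    kaczmarzStep a b x - h = residual a (x - h) := by
  subst hab
  simp only [kaczmarzStep, residual, colProj, WithLp.ofLp_sub, ← Matrix.mulVec_sub,
    Matrix.mulVec_mulVec]
  abel

/-- Pythagoras, since `colProj a` is symmetric and idempotent. -/
theorem norm_residual_sq (a : Matrix (Fin d) (Fin p) ℝ) (v : EuclideanSpace ℝ (Fin d)) :
    ‖residual a v‖ ^ 2 = ‖v‖ ^ 2 - ‖WithLp.toLp 2 (colProj a *ᵥ v.ofLp)‖ ^ 2 := by
  have h : inner ℝ v (WithLp.toLp 2 (colProj a *ᵥ v.ofLp)) =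
      ‖WithLp.toLp 2 (colProj a *ᵥ v.ofLp)‖ ^ 2 := by
    rw [← real_inner_self_eq_norm_sq, EuclideanSpace.inner_eq_star_dotProduct,
      EuclideanSpace.inner_eq_star_dotProduct]
    simp only [star_trivial]
    rw [Matrix.dotProduct_mulVec, Matrix.vecMul_mulVec, colProj_transpose, colProj_mul_self,
      ← Matrix.mulVec_transpose, colProj_transpose]
  rw [residual, norm_sub_sq_real, h]
  ring

theorem norm_residual_sq_le (a : Matrix (Fin d) (Fin p) ℝ) (v : EuclideanSpace ℝ (Fin d)) :
    ‖residual a v‖ ^ 2 ≤ ‖v‖ ^ 2 := by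
  rw [norm_residual_sq]
  exact sub_le_self _ (sq_nonneg _)

theorem transpose_mulVec_eq_zero_of_norm_residual {a : Matrix (Fin d) (Fin p) ℝ}
    {v : EuclideanSpace ℝ (Fin d)} (h : ‖residual a v‖ ^ 2 = ‖v‖ ^ 2) : aᵀ *ᵥ v.ofLp = 0 := by
  have h0 : colProj a *ᵥ v.ofLp = 0 := by
    rw [norm_residual_sq] at h
    simpa using h
  have h1 := congrArg (fun w => aᵀ *ᵥ w) h0
  simp only [Matrix.mulVec_mulVec, Matrix.mulVec_zero] at h1
  rwa [← colProj_transpose, ← Matrix.transpose_mul, colProj_mul] at h1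

/-- `colProj a` is symmetric and kills `n`. This is what keeps the error orthogonal to the direction
of `H`. -/
theorem inner_residual {a : Matrix (Fin d) (Fin p) ℝ} {n : EuclideanSpace ℝ (Fin d)}
    (hn : aᵀ *ᵥ n.ofLp = 0) (v : EuclideanSpace ℝ (Fin d)) :
    inner ℝ n (residual a v) = inner ℝ n v := by
  have h : inner ℝ n (WithLp.toLp 2 (colProj a *ᵥ v.ofLp)) = 0 := by
    rw [real_inner_comm, EuclideanSpace.inner_eq_star_dotProduct]
    simp only [star_trivial]
    rw [Matrix.dotProduct_mulVec, ← Matrix.mulVec_transpose, colProj_transpose, colProj,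
      ← Matrix.mulVec_mulVec, hn, Matrix.mulVec_zero, zero_dotProduct]
  rw [residual, inner_sub_right, h, sub_zero]

theorem residual_smul (a : Matrix (Fin d) (Fin p) ℝ) (c : ℝ) (v : EuclideanSpace ℝ (Fin d)) :
    residual a (c • v) = c • residual a v := by
  simp [residual, Matrix.mulVec_smul, smul_sub]

theorem continuous_residual (a : Matrix (Fin d) (Fin p) ℝ) : Continuous (residual a) := by
  unfold residual
  fun_prop

/-! ### Measurability of the pseudo-inverse and of the step. -/

instance {m n : ℕ} : BorelSpace (Matrix (Fin m) (Fin n) ℝ) :=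
  inferInstanceAs (BorelSpace (Fin m → Fin n → ℝ))

instance {m n : ℕ} : PolishSpace (Matrix (Fin m) (Fin n) ℝ) :=
  inferInstanceAs (PolishSpace (Fin m → Fin n → ℝ))

instance {m n : ℕ} : SecondCountableTopology (Matrix (Fin m) (Fin n) ℝ) :=
  inferInstanceAs (SecondCountableTopology (Fin m → Fin n → ℝ))

theorem isClosed_isMoorePenrose {m n : ℕ} :
    IsClosed {z : Matrix (Fin m) (Fin n) ℝ × Matrix (Fin n) (Fin m) ℝ |
      IsMoorePenrose z.1 z.2} := by
  have : {z : Matrix (Fin m) (Fin n) ℝ × Matrix (Fin n) (Fin m) ℝ | IsMoorePenrose z.1 z.2} =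
      {z | z.1 * z.2 * z.1 = z.1} ∩ {z | z.2 * z.1 * z.2 = z.2} ∩
        {z | (z.1 * z.2)ᵀ = z.1 * z.2} ∩ {z | (z.2 * z.1)ᵀ = z.2 * z.1} := by
    ext z
    exact ⟨fun h => ⟨⟨⟨h.1, h.2⟩, h.3⟩, h.4⟩, fun h => ⟨h.1.1.1, h.1.1.2, h.1.2, h.2⟩⟩
  rw [this]
  refine ((IsClosed.inter ?_ ?_).inter ?_).inter ?_ <;>
    exact isClosed_eq (by fun_prop) (by fun_prop)

/-- The graph of `pinv` is closed and projects injectively to the first factor, so `pinv` is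
measurable by the Lusin-Souslin theorem. -/
theorem measurable_pinv {m n : ℕ} :
    Measurable (pinv : Matrix (Fin m) (Fin n) ℝ → Matrix (Fin n) (Fin m) ℝ) := by
  have he := ContinuousOn.measurableEmbedding isClosed_isMoorePenrose.measurableSet
    (f := Prod.fst) continuous_fst.continuousOn
    (fun (z : Matrix (Fin m) (Fin n) ℝ × Matrix (Fin n) (Fin m) ℝ) hz w hw h =>
      Prod.ext h (IsMoorePenrose.unique hz (by rw [h]; exact hw)))
  intro s hs
  have himg := he.measurableSet_image.2
    ((measurable_snd.comp measurable_subtype_coe) hs)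
  convert himg using 1
  ext A
  constructor
  · exact fun hA => ⟨⟨(A, pinv A), pinv_spec A⟩, hA, rfl⟩
  · rintro ⟨⟨⟨B, X⟩, hBX⟩, hX, rfl⟩
    have : pinv B = X := (pinv_spec B).unique hBX
    simpa [Set.domRestrict, this] using hX

theorem measurable_kaczmarzStep :
    Measurable fun z : (Matrix (Fin d) (Fin p) ℝ × (Fin p → ℝ)) × EuclideanSpace ℝ (Fin d) =>
      kaczmarzStep z.1.1 z.1.2 z.2 := by
  -- The pseudo-inverse is only measurable, so it enters as a separate variable in which the step is
  -- continuous.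
  have hc : Continuous fun w : (Matrix (Fin d) (Fin p) ℝ × Matrix (Fin p) (Fin p) ℝ) ×
      (Fin p → ℝ) × EuclideanSpace ℝ (Fin d) =>
      w.2.2 - WithLp.toLp 2 ((w.1.1 * w.1.2) *ᵥ (w.1.1ᵀ *ᵥ w.2.2.ofLp - w.2.1)) := by
    fun_prop
  have hg : Measurable fun a : Matrix (Fin d) (Fin p) ℝ => pinv (aᵀ * a) :=
    measurable_pinv.comp
      (Continuous.measurable (f := fun a : Matrix (Fin d) (Fin p) ℝ => aᵀ * a) (by fun_prop))
  exact hc.measurable.comp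
    (((measurable_fst.comp measurable_fst).prodMk
      (hg.comp (measurable_fst.comp measurable_fst))).prodMk
      ((measurable_snd.comp measurable_fst).prodMk measurable_snd))

theorem measurable_residual (v : EuclideanSpace ℝ (Fin d)) :
    Measurable fun a : Matrix (Fin d) (Fin p) ℝ => residual a v := by
  have h : (fun a : Matrix (Fin d) (Fin p) ℝ => residual a v) =
      fun a => kaczmarzStep a 0 v := by
    funext a
    simp [residual, kaczmarzStep, colProj, Matrix.mulVec_mulVec]
  rw [h]
  exact measurable_kaczmarzStep.comp ((measurable_id.prodMk measurable_const).prodMk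
    measurable_const)

/-! ### Mean-square contraction of the residual. -/

theorem integrable_norm_residual_sq (ν : Measure (Matrix (Fin d) (Fin p) ℝ × (Fin p → ℝ)))
    [IsProbabilityMeasure ν] (v : EuclideanSpace ℝ (Fin d)) :
    Integrable (fun z => ‖residual z.1 v‖ ^ 2) ν := by
  refine Integrable.of_bound (C := ‖v‖ ^ 2)
    (((measurable_residual v).comp measurable_fst).norm.pow_const 2).aestronglyMeasurable
    (ae_of_all _ fun z => ?_)
  rw [Real.norm_of_nonneg (sq_nonneg _)]
  exact norm_residual_sq_le _ _

/-- The loss `‖v‖ ^ 2 - ‖residual z.1 v‖ ^ 2` is nonnegative; if its mean vanishes, it is almost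
surely zero, and then `v` is orthogonal to the columns. -/
theorem integral_norm_residual_sq_lt (ν : Measure (Matrix (Fin d) (Fin p) ℝ × (Fin p → ℝ)))
    [IsProbabilityMeasure ν] {v : EuclideanSpace ℝ (Fin d)}
    (hv : ¬ ∀ᵐ z ∂ν, z.1ᵀ *ᵥ v.ofLp = 0) :
    ∫ z, ‖residual z.1 v‖ ^ 2 ∂ν < ‖v‖ ^ 2 := by
  by_contra! hle
  refine hv ?_
  have hint := integrable_norm_residual_sq ν v
  have h0 : ∫ z, (‖v‖ ^ 2 - ‖residual z.1 v‖ ^ 2) ∂ν ≤ 0 := by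
    rw [integral_sub (integrable_const _) hint]
    simpa using hle
  have hnn : 0 ≤ fun z : Matrix (Fin d) (Fin p) ℝ × (Fin p → ℝ) =>
      ‖v‖ ^ 2 - ‖residual z.1 v‖ ^ 2 := fun z => sub_nonneg.2 (norm_residual_sq_le _ _)
  have h1 := (integral_eq_zero_iff_of_nonneg hnn ((integrable_const _).sub hint)).1
    (h0.antisymm (integral_nonneg hnn))
  filter_upwards [h1] with z hz
  exact transpose_mulVec_eq_zero_of_norm_residual (sub_eq_zero.1 hz).symm

/-- On a subspace containing no nonzero vector that is almost surely orthogonal to all columns, the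
residual contracts in mean square by a uniform factor. -/
theorem exists_integral_norm_residual_sq_le
    (ν : Measure (Matrix (Fin d) (Fin p) ℝ × (Fin p → ℝ))) [IsProbabilityMeasure ν]
    (V : Submodule ℝ (EuclideanSpace ℝ (Fin d)))
    (hV : ∀ v ∈ V, (∀ᵐ z ∂ν, z.1ᵀ *ᵥ v.ofLp = 0) → v = 0) :
    ∃ c : ℝ, 0 < c ∧ c < 1 ∧ ∀ v ∈ V, ∫ z, ‖residual z.1 v‖ ^ 2 ∂ν ≤ c * ‖v‖ ^ 2 := by
  set g : EuclideanSpace ℝ (Fin d) → ℝ := fun v => ∫ z, ‖residual z.1 v‖ ^ 2 ∂ν with hg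
  have hcompact : IsCompact (Metric.sphere (0 : EuclideanSpace ℝ (Fin d)) 1 ∩ V) :=
    (isCompact_sphere _ _).inter_right V.closed_of_finiteDimensional
  have hcont : ContinuousOn g (Metric.sphere (0 : EuclideanSpace ℝ (Fin d)) 1 ∩ V) := by
    refine continuousOn_of_dominated (bound := fun _ => 1)
      (fun v _ => (integrable_norm_residual_sq ν v).aestronglyMeasurable)
      (fun v hv => ae_of_all _ fun z => ?_) (integrable_const _)
      (ae_of_all _ fun z => ((continuous_residual z.1).norm.pow 2).continuousOn)
    rw [Real.norm_of_nonneg (sq_nonneg _)]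
    have h1 : ‖v‖ = 1 := by simpa using hv.1
    simpa [h1] using norm_residual_sq_le z.1 v
  obtain ⟨c, hc0, hc1, hc⟩ : ∃ c : ℝ, 0 < c ∧ c < 1 ∧
      ∀ u ∈ Metric.sphere (0 : EuclideanSpace ℝ (Fin d)) 1 ∩ V, g u ≤ c := by
    -- The sphere is empty when `V = 0`. The value `1 / 2`, here and in the maximum below, only
    -- keeps `c` positive, as `γbar` must be.
    rcases (Metric.sphere (0 : EuclideanSpace ℝ (Fin d)) 1 ∩ (V : Set _)).eq_empty_or_nonempty
      with he | hne
    · exact ⟨1 / 2, by norm_num, by norm_num, by simp [he]⟩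
    · obtain ⟨w, hw, hmax⟩ := hcompact.exists_isMaxOn hne hcont
      have hw1 : ‖w‖ = 1 := by simpa using hw.1
      have hlt : g w < 1 := by
        have hw0 : ¬ ∀ᵐ z ∂ν, z.1ᵀ *ᵥ w.ofLp = 0 := fun h => by
          simp [hV w hw.2 h] at hw1
        simpa [hw1] using integral_norm_residual_sq_lt ν hw0
      exact ⟨max (g w) (1 / 2), lt_max_of_lt_right (by norm_num), max_lt hlt (by norm_num),
        fun u hu => (hmax hu).trans (le_max_left _ _)⟩
  refine ⟨c, hc0, hc1, fun v hv => ?_⟩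
  rcases eq_or_ne v 0 with rfl | hv0
  · simp [residual]
  have hvn : ‖v‖ ≠ 0 := norm_ne_zero_iff.2 hv0
  have hu := hc (‖v‖⁻¹ • v) ⟨by simp [norm_smul, hvn], V.smul_mem _ hv⟩
  have hscale : g (‖v‖⁻¹ • v) = (‖v‖ ^ 2)⁻¹ * g v := by
    simp only [hg, residual_smul, norm_smul, norm_inv, norm_norm, mul_pow, inv_pow,
      integral_const_mul]
  rw [hscale] at hu
  have hpos : 0 < ‖v‖ ^ 2 := by positivity
  rwa [inv_mul_le_iff₀ hpos, mul_comm] at hu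

/-! ### The solution space and its direction. -/

theorem mem_direction_solutionSpace {μ : Measure Ω} {a : Ω → Matrix (Fin d) (Fin p) ℝ}
    {b : Ω → Fin p → ℝ} {h : EuclideanSpace ℝ (Fin d)} (hh : h ∈ solutionSpace μ a b)
    {v : EuclideanSpace ℝ (Fin d)} :
    v ∈ (solutionSpace μ a b).direction ↔ ∀ᵐ ω ∂μ, (a ω)ᵀ *ᵥ v.ofLp = 0 := by
  rw [← AffineSubspace.vadd_mem_iff_mem_direction v hh]
  change (∀ᵐ ω ∂μ, (a ω)ᵀ *ᵥ (v + h).ofLp = b ω) ↔ _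
  have hh' : ∀ᵐ ω ∂μ, (a ω)ᵀ *ᵥ h.ofLp = b ω := hh
  refine eventually_congr ?_
  filter_upwards [hh'] with ω hω
  rw [WithLp.ofLp_add, Matrix.mulVec_add, hω, add_eq_right]

/-- One null set must serve uncountably many `v`; a finite basis makes this possible. -/
theorem ae_forall_mem_direction_solutionSpace {μ : Measure Ω}
    {a : Ω → Matrix (Fin d) (Fin p) ℝ} {b : Ω → Fin p → ℝ} {h : EuclideanSpace ℝ (Fin d)}
    (hh : h ∈ solutionSpace μ a b) :
    ∀ᵐ ω ∂μ, ∀ v ∈ (solutionSpace μ a b).direction, (a ω)ᵀ *ᵥ v.ofLp = 0 := by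
  let e := Module.finBasis ℝ (solutionSpace μ a b).direction
  have he : ∀ᵐ ω ∂μ, ∀ i, (a ω)ᵀ *ᵥ (e i : EuclideanSpace ℝ (Fin d)).ofLp = 0 :=
    ae_all_iff.2 fun i => (mem_direction_solutionSpace hh).1 (e i).2
  filter_upwards [he] with ω hω v hv
  have hsum := congrArg (fun w : (solutionSpace μ a b).direction =>
    (w : EuclideanSpace ℝ (Fin d)).ofLp) (e.sum_repr ⟨v, hv⟩)
  simp only [Submodule.coe_sum, Submodule.coe_smul, WithLp.ofLp_sum, WithLp.ofLp_smul] at hsum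
  rw [← hsum, Matrix.mulVec_sum]
  exact Finset.sum_eq_zero fun i _ => by rw [Matrix.mulVec_smul, hω, smul_zero]

/-! ### Iterates along the stream. -/

theorem measurable_kaczmarzIterate (α : ℕ → Ω → Matrix (Fin d) (Fin p) ℝ)
    (β : ℕ → Ω → Fin p → ℝ) (hα : ∀ k, Measurable (α k)) (hβ : ∀ k, Measurable (β k))
    (x₀ : EuclideanSpace ℝ (Fin d)) (k : ℕ) :
    Measurable[streamFiltration α β hα hβ k] (kaczmarzIterate α β x₀ k) := by
  induction k with
  | zero => exact measurable_const
  | succ k ih =>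
    have hz : Measurable[streamFiltration α β hα hβ (k + 1)] fun ω => (α k ω, β k ω) :=
      Measurable.mono (comap_measurable _)
        (le_iSup (fun i : Fin (k + 1) =>
          MeasurableSpace.comap (fun ω => (α i ω, β i ω)) inferInstance) (Fin.last k)) le_rfl
    have hx := ih.mono ((streamFiltration α β hα hβ).mono k.le_succ) le_rfl
    exact measurable_kaczmarzStep.comp (hz.prodMk hx)

/-- Iterate `k` depends only on samples with index below `k`. -/
theorem indepFun_kaczmarzIterate {μ : Measure Ω} {α : ℕ → Ω → Matrix (Fin d) (Fin p) ℝ}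
    {β : ℕ → Ω → Fin p → ℝ} (hα : ∀ k, Measurable (α k)) (hβ : ∀ k, Measurable (β k))
    (hindep : iIndepFun (fun k ω => (α k ω, β k ω)) μ) (x₀ : EuclideanSpace ℝ (Fin d)) (k : ℕ) :
    IndepFun (kaczmarzIterate α β x₀ k) (fun ω => (α k ω, β k ω)) μ := by
  have h := indep_iSup_of_disjoint (fun i => ((hα i).prodMk (hβ i)).comap_le)
    ((iIndepFun_iff_iIndep _ _ _).1 hindep) (S := Set.Iio k) (T := {k}) (by simp)
  rw [iSup_singleton] at h
  refine (IndepFun_iff_Indep _ _ _).2 (indep_of_indep_of_le_left h ?_)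
  refine (measurable_kaczmarzIterate α β hα hβ x₀ k).comap_le.trans (iSup_le fun i => ?_)
  exact le_iSup₂_of_le (i : ℕ) i.2 le_rfl

theorem measurableSet_transpose_mulVec_eq (x : EuclideanSpace ℝ (Fin d)) :
    MeasurableSet {z : Matrix (Fin d) (Fin p) ℝ × (Fin p → ℝ) | z.1ᵀ *ᵥ x.ofLp = z.2} :=
  (isClosed_eq (by fun_prop) (by fun_prop)).measurableSet

theorem solutionSpace_eq_of_identDistrib {μ : Measure Ω}
    {a a' : Ω → Matrix (Fin d) (Fin p) ℝ} {b b' : Ω → Fin p → ℝ}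
    (h : IdentDistrib (fun ω => (a ω, b ω)) (fun ω => (a' ω, b' ω)) μ μ) :
    solutionSpace μ a b = solutionSpace μ a' b' := by
  ext x
  exact ⟨fun hx => h.ae_snd (measurableSet_transpose_mulVec_eq x) hx,
    fun hx => h.symm.ae_snd (measurableSet_transpose_mulVec_eq x) hx⟩

section Stream

variable {μ : Measure Ω} {α : ℕ → Ω → Matrix (Fin d) (Fin p) ℝ}
  {β : ℕ → Ω → Fin p → ℝ}

theorem ae_kaczmarzIterate_sub_mem
    (hident : ∀ k, IdentDistrib (fun ω => (α k ω, β k ω)) (fun ω => (α 0 ω, β 0 ω)) μ μ)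
    {h x₀ : EuclideanSpace ℝ (Fin d)} (hh : h ∈ solutionSpace μ (α 0) (β 0))
    (hx₀ : x₀ - h ∈ (solutionSpace μ (α 0) (β 0)).directionᗮ) (k : ℕ) :
    ∀ᵐ ω ∂μ, kaczmarzIterate α β x₀ k ω - h ∈ (solutionSpace μ (α 0) (β 0)).directionᗮ := by
  induction k with
  | zero => exact ae_of_all _ fun _ => hx₀
  | succ k ih =>
    have heq := solutionSpace_eq_of_identDistrib (hident k)
    have hk : h ∈ solutionSpace μ (α k) (β k) := heq ▸ hh
    have hkb : ∀ᵐ ω ∂μ, (α k ω)ᵀ *ᵥ h.ofLp = β k ω := hk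
    filter_upwards [ih, hkb, ae_forall_mem_direction_solutionSpace hk] with ω h1 h2 h3
    rw [heq] at h3
    rw [Submodule.mem_orthogonal] at h1 ⊢
    intro n hn
    rw [kaczmarzIterate, kaczmarzStep_sub h2, inner_residual (h3 n hn), h1 n hn]

theorem lintegral_kaczmarzStep_sub_le [IsProbabilityMeasure μ]
    (hα : ∀ k, Measurable (α k)) (hβ : ∀ k, Measurable (β k))
    {h : EuclideanSpace ℝ (Fin d)} (hh : h ∈ solutionSpace μ (α 0) (β 0)) {c : ℝ}
    {x : EuclideanSpace ℝ (Fin d)}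
    (hc : ∫ z, ‖residual z.1 (x - h)‖ ^ 2 ∂(μ.map fun ω => (α 0 ω, β 0 ω)) ≤ c * ‖x - h‖ ^ 2) :
    ∫⁻ z, ENNReal.ofReal (‖kaczmarzStep z.1 z.2 x - h‖ ^ 2) ∂(μ.map fun ω => (α 0 ω, β 0 ω)) ≤
      ENNReal.ofReal (c * ‖x - h‖ ^ 2) := by
  have hm : Measurable fun ω => (α 0 ω, β 0 ω) := (hα 0).prodMk (hβ 0)
  have : IsProbabilityMeasure (μ.map fun ω => (α 0 ω, β 0 ω)) :=
    Measure.isProbabilityMeasure_map hm.aemeasurable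
  have hae : ∀ᵐ z ∂(μ.map fun ω => (α 0 ω, β 0 ω)), z.1ᵀ *ᵥ h.ofLp = z.2 :=
    (ae_map_iff hm.aemeasurable (measurableSet_transpose_mulVec_eq h)).2 hh
  refine le_trans (le_of_eq ?_) (ENNReal.ofReal_le_ofReal hc)
  rw [ofReal_integral_eq_lintegral_ofReal (integrable_norm_residual_sq _ _)
    (ae_of_all _ fun _ => sq_nonneg _)]
  refine lintegral_congr_ae ?_
  filter_upwards [hae] with z hz
  rw [kaczmarzStep_sub hz]

/-- By independence the joint law of iterate and new sample is a product, so Tonelli allows the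
one-step bound to be applied with the iterate frozen. -/
theorem lintegral_kaczmarzIterate_sub_le [IsProbabilityMeasure μ]
    (hα : ∀ k, Measurable (α k)) (hβ : ∀ k, Measurable (β k))
    (hindep : iIndepFun (fun k ω => (α k ω, β k ω)) μ)
    (hident : ∀ k, IdentDistrib (fun ω => (α k ω, β k ω)) (fun ω => (α 0 ω, β 0 ω)) μ μ)
    {h x₀ : EuclideanSpace ℝ (Fin d)} (hh : h ∈ solutionSpace μ (α 0) (β 0))
    (hx₀ : x₀ - h ∈ (solutionSpace μ (α 0) (β 0)).directionᗮ) {c : ℝ} (hc0 : 0 ≤ c)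
    (hc : ∀ v ∈ (solutionSpace μ (α 0) (β 0)).directionᗮ,
      ∫ z, ‖residual z.1 v‖ ^ 2 ∂(μ.map fun ω => (α 0 ω, β 0 ω)) ≤ c * ‖v‖ ^ 2) (k : ℕ) :
    ∫⁻ ω, ENNReal.ofReal (‖kaczmarzIterate α β x₀ k ω - h‖ ^ 2) ∂μ ≤
      ENNReal.ofReal (c ^ k * ‖x₀ - h‖ ^ 2) := by
  induction k with
  | zero => simp [kaczmarzIterate]
  | succ k ih =>
    have hm : Measurable fun ω => (α k ω, β k ω) := (hα k).prodMk (hβ k)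
    have hx : Measurable (kaczmarzIterate α β x₀ k) :=
      (measurable_kaczmarzIterate α β hα hβ x₀ k).mono ((streamFiltration α β hα hβ).le k) le_rfl
    have : IsProbabilityMeasure (μ.map fun ω => (α 0 ω, β 0 ω)) :=
      Measure.isProbabilityMeasure_map ((hα 0).prodMk (hβ 0)).aemeasurable
    have hf : Measurable fun w : EuclideanSpace ℝ (Fin d) ×
        (Matrix (Fin d) (Fin p) ℝ × (Fin p → ℝ)) =>
        ENNReal.ofReal (‖kaczmarzStep w.2.1 w.2.2 w.1 - h‖ ^ 2) :=
      (((measurable_kaczmarzStep.comp measurable_swap).sub_const h).norm.pow_const 2).ennreal_ofReal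
    have hmap := (indepFun_kaczmarzIterate hα hβ hindep x₀ k).map_prod_eq_prod_map_map
      hx.aemeasurable hm.aemeasurable
    rw [(hident k).map_eq] at hmap
    calc ∫⁻ ω, ENNReal.ofReal (‖kaczmarzIterate α β x₀ (k + 1) ω - h‖ ^ 2) ∂μ
        = ∫⁻ w, ENNReal.ofReal (‖kaczmarzStep w.2.1 w.2.2 w.1 - h‖ ^ 2)
            ∂(μ.map fun ω => (kaczmarzIterate α β x₀ k ω, α k ω, β k ω)) :=
          (lintegral_map hf (hx.prodMk hm)).symm
      _ = ∫⁻ ω, ∫⁻ z, ENNReal.ofReal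
            (‖kaczmarzStep z.1 z.2 (kaczmarzIterate α β x₀ k ω) - h‖ ^ 2)
            ∂(μ.map fun ω => (α 0 ω, β 0 ω)) ∂μ := by
          rw [hmap, lintegral_prod _ hf.aemeasurable, lintegral_map hf.lintegral_prod_right' hx]
      _ ≤ ∫⁻ ω, ENNReal.ofReal c *
            ENNReal.ofReal (‖kaczmarzIterate α β x₀ k ω - h‖ ^ 2) ∂μ := by
          refine lintegral_mono_ae ?_
          filter_upwards [ae_kaczmarzIterate_sub_mem hident hh hx₀ k] with ω hω
          rw [← ENNReal.ofReal_mul hc0]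
          exact lintegral_kaczmarzStep_sub_le hα hβ hh (hc _ hω)
      _ ≤ ENNReal.ofReal c * ENNReal.ofReal (c ^ k * ‖x₀ - h‖ ^ 2) := by
          rw [lintegral_const_mul' _ _ ENNReal.ofReal_ne_top]
          gcongr
      _ = ENNReal.ofReal (c ^ (k + 1) * ‖x₀ - h‖ ^ 2) := by
          rw [← ENNReal.ofReal_mul hc0]
          congr 1
          ring

end Stream

/-! ### From geometric means to almost sure decay, and the conclusion. -/

/-- If the means of nonnegative random variables decay geometrically at rate `c`, then almost surely
the variables eventually decay geometrically at every rate `γ > c`. -/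
theorem ae_eventually_le_of_lintegral_le_geometric {μ : Measure Ω} {f : ℕ → Ω → ℝ}
    (hf : ∀ j, Measurable (f j)) {c γ C : ℝ} (hc : 0 ≤ c) (hγ : c < γ) (hC : 0 < C)
    (hle : ∀ j, ∫⁻ ω, ENNReal.ofReal (f j ω) ∂μ ≤ ENNReal.ofReal (c ^ j * C)) :
    ∀ᵐ ω ∂μ, ∀ᶠ j in atTop, f j ω ≤ γ ^ j * C := by
  have hγ0 : 0 < γ := hc.trans_lt hγ
  have hr0 : 0 ≤ c / γ := by positivity
  -- Markov's inequality; the ratio `c / γ < 1` makes the bounds summable for Borel-Cantelli.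
  have hmarkov : ∀ j, μ {ω | γ ^ j * C < f j ω} ≤ ENNReal.ofReal ((c / γ) ^ j) := by
    intro j
    have hpos : 0 < γ ^ j * C := by positivity
    calc μ {ω | γ ^ j * C < f j ω}
        ≤ μ {ω | ENNReal.ofReal (γ ^ j * C) ≤ ENNReal.ofReal (f j ω)} :=
          measure_mono fun ω hω => ENNReal.ofReal_le_ofReal (le_of_lt hω)
      _ ≤ (∫⁻ ω, ENNReal.ofReal (f j ω) ∂μ) / ENNReal.ofReal (γ ^ j * C) :=
          meas_ge_le_lintegral_div (hf j).ennreal_ofReal.aemeasurable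
            (by simpa using hpos) ENNReal.ofReal_ne_top
      _ ≤ ENNReal.ofReal (c ^ j * C) / ENNReal.ofReal (γ ^ j * C) := by
          gcongr
          exact hle j
      _ = ENNReal.ofReal ((c / γ) ^ j) := by
          rw [← ENNReal.ofReal_div_of_pos hpos, mul_div_mul_right _ _ hC.ne', div_pow]
  have hsum : ∑' j, μ {ω | γ ^ j * C < f j ω} ≠ ∞ := by
    refine ne_top_of_le_ne_top ?_ (ENNReal.tsum_le_tsum hmarkov)
    rw [← ENNReal.ofReal_tsum_of_nonneg (fun j => pow_nonneg hr0 j)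
      (summable_geometric_of_lt_one hr0 ((div_lt_one hγ0).2 hγ))]
    exact ENNReal.ofReal_ne_top
  filter_upwards [ae_eventually_notMem hsum] with ω hω
  filter_upwards [hω] with j hj
  exact not_lt.1 hj

theorem expectedTime_const (μ : Measure Ω) [IsProbabilityMeasure μ] (j : ℕ) :
    expectedTime μ (fun _ => (j : WithTop ℕ)) = j := by
  have hj : ENat.toENNReal (j : WithTop ℕ) = j := ENat.toENNReal_coe j
  simp [expectedTime, hj]

end StreamingKaczmarz

end

theorem mainTheorem10 {Ω : Type*} [MeasurableSpace Ω] (μ : Measure Ω) [IsProbabilityMeasure μ]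
    {d p : ℕ} (α : ℕ → Ω → Matrix (Fin d) (Fin p) ℝ) (β : ℕ → Ω → Fin p → ℝ)
    (hα : ∀ k, Measurable (α k)) (hβ : ∀ k, Measurable (β k))
    (hindep : iIndepFun (fun k ω => (α k ω, β k ω)) μ)
    (hident : ∀ k, IdentDistrib (fun ω => (α k ω, β k ω)) (fun ω => (α 0 ω, β 0 ω)) μ μ)
    [Nonempty (solutionSpace μ (α 0) (β 0))]
    (x₀ : EuclideanSpace ℝ (Fin d)) :
    (∃ τ : Ω → WithTop ℕ, IsStoppingTime (streamFiltration α β hα hβ) τ ∧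
      expectedTime μ τ ≠ ∞ ∧
      ∀ᵐ ω ∂μ, stoppedValue (kaczmarzIterate α β x₀) τ ω ∈ solutionSpace μ (α 0) (β 0)) ∨
    (∃ π : ℝ, 0 < π ∧ π ≤ 1 ∧
      ∃ τ : ℕ → Ω → WithTop ℕ,
        (∀ j, IsStoppingTime (streamFiltration α β hα hβ) (τ j)) ∧
        (∀ j, expectedTime μ (τ j) ≠ ∞ ∧
          (expectedTime μ (τ j)).toReal ≤
            (j : ℝ) * (((d : ℝ) -
              (Module.finrank ℝ (solutionSpace μ (α 0) (β 0)).direction : ℝ) - 1) / π + 1)) ∧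
        ∃ γbar : ℝ, 0 < γbar ∧ γbar < 1 ∧
          ∀ γ : ℝ, γbar < γ → γ < 1 →
            ∀ᵐ ω ∂μ, ∃ L : ℕ, ∀ j ≥ L,
              ‖stoppedValue (kaczmarzIterate α β x₀) (τ j) ω -
                  (EuclideanGeometry.orthogonalProjection (solutionSpace μ (α 0) (β 0)) x₀ :
                    EuclideanSpace ℝ (Fin d))‖ ^ 2 ≤
                γ ^ j * ‖x₀ -
                  (EuclideanGeometry.orthogonalProjection (solutionSpace μ (α 0) (β 0)) x₀ :
                    EuclideanSpace ℝ (Fin d))‖ ^ 2) := by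
  set H := solutionSpace μ (α 0) (β 0)
  set h : EuclideanSpace ℝ (Fin d) := ((EuclideanGeometry.orthogonalProjection H x₀ : H) :)
  have hh : h ∈ H := EuclideanGeometry.orthogonalProjection_mem x₀
  have hx₀ : x₀ - h ∈ H.directionᗮ :=
    EuclideanGeometry.vsub_orthogonalProjection_mem_direction_orthogonal H x₀
  -- For `x₀ ≠ h` the initial error is positive, as Markov's inequality needs, and `H` is not the
  -- whole space, as the time bound needs.
  rcases eq_or_ne x₀ h with heq | hne
  · refine Or.inl ⟨fun _ => ((0 : ℕ) : WithTop ℕ), isStoppingTime_const _ 0, ?_, ?_⟩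
    · rw [expectedTime_const]
      exact ENNReal.natCast_ne_top 0
    · refine ae_of_all _ fun ω => ?_
      change x₀ ∈ H
      rwa [heq]
  · refine Or.inr ⟨1, one_pos, le_rfl, fun j _ => (j : WithTop ℕ),
      fun j => isStoppingTime_const _ j, fun j => ?_, ?_⟩
    · have hlt : Module.finrank ℝ H.direction < d := by
        have htop : H.direction ≠ ⊤ := fun ht => by
          rw [ht, Submodule.top_orthogonal_eq_bot, Submodule.mem_bot] at hx₀
          exact hne (sub_eq_zero.1 hx₀)
        simpa using Submodule.finrank_lt htop
      refine ⟨by simp [expectedTime_const], ?_⟩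
      -- With `π = 1` the bracket equals `d - dim H ≥ 1`, so it dominates the factor `1` in `E[τ j]
      -- = j`.
      have hle : (Module.finrank ℝ H.direction : ℝ) + 1 ≤ d := by exact_mod_cast hlt
      rw [expectedTime_const, ENNReal.toReal_natCast, div_one]
      exact le_mul_of_one_le_right j.cast_nonneg (by linarith)
    · have hm : Measurable fun ω => (α 0 ω, β 0 ω) := (hα 0).prodMk (hβ 0)
      have : IsProbabilityMeasure (μ.map fun ω => (α 0 ω, β 0 ω)) :=
        Measure.isProbabilityMeasure_map hm.aemeasurable
      -- A vector almost surely orthogonal to the columns lies in the direction of `H`; if it is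
      -- also in the complement, it is zero.
      obtain ⟨c, hc0, hc1, hc⟩ := exists_integral_norm_residual_sq_le
        (μ.map fun ω => (α 0 ω, β 0 ω)) H.directionᗮ fun v hv hv0 => by
          have hvd : v ∈ H.direction :=
            (mem_direction_solutionSpace hh).2 (ae_of_ae_map hm.aemeasurable hv0)
          exact inner_self_eq_zero.1 ((Submodule.mem_orthogonal _ _).1 hv v hvd)
      refine ⟨c, hc0, hc1, fun γ hγ _ => ?_⟩
      have hbound := lintegral_kaczmarzIterate_sub_le hα hβ hindep hident hh hx₀ hc0.le hc
      have hpos : 0 < ‖x₀ - h‖ ^ 2 := by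
        have := norm_pos_iff.2 (sub_ne_zero.2 hne)
        positivity
      have hmeas : ∀ j, Measurable fun ω => ‖kaczmarzIterate α β x₀ j ω - h‖ ^ 2 := fun j =>
        (((measurable_kaczmarzIterate α β hα hβ x₀ j).mono
          ((streamFiltration α β hα hβ).le j) le_rfl).sub_const h).norm.pow_const 2
      filter_upwards [ae_eventually_le_of_lintegral_le_geometric hmeas hc0.le hγ hpos hbound]
        with ω hω
      exact eventually_atTop.1 hω
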